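/- Let $\Gamma$ be a countable group and $S$ a finite symmetric generating set of $\Gamma$ not containing the identity. Let $\Gamma$ act on $2^\Gamma=\{0,1\}^\Gamma$ (with the product topology) by $(g\cdot x)(h)=x(g^{-1}h)$, and let $F(2^\Gamma)=\{x\in 2^\Gamma : g\cdot x\neq x \text{ for all } g\in\Gamma\setminus\{\mathrm{id}\}\}$ with the subspace topology. The shift graph of $(\Gamma,S)$, also denoted $F(2^\Gamma)$, is the graph on the set $F(2^\Gamma)$ in which $x$ and $y$ are adjacent if and only if $s\cdot x=y$ for some $s\in S$. For a graph $G$ on a Polish space $X$ and a Borel probability measure $\mu$ on $X$, let $\chi_\mu(G)\in\mathbb{N}\cup\{\infty\}$ be the least $n$ such that $G$ has a $\mu$-measurable proper $n$-coloring, i.e. a map $c:X\to\{1,\dots,n\}$ with $c(x)\neq c(y)$ whenever $x,y$ are adjacent, each of whose color sets is measurable for the completion of $\mu$ ($\chi_\mu(G)=\infty$ if there is no such $n$). Let $\chi_M(G)$ be the supremum of $\chi_\mu(G)$ over all Borel probability measures $\mu$ on $X$. For $k\geq 3$ let $Z_k=\mathbb{Z}/k\mathbb{Z}$ and $S_k=\{(a,b)\in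 Z_k\times Z_k : a\neq 0,\ b\neq 0\}$. Let $\Delta_k$ be the direct product $(Z_k\times Z_k)\times\mathbb{Z}$, and let $\Gamma_k$ be the semidirect product $(Z_k\times Z_k)\rtimes\mathbb{Z}$ in which $1\in\mathbb{Z}$ acts on $Z_k\times Z_k$ by $(a,b)\mapsto(b,a)$; both have the generating set $S_k\times\{-1,0,1\}$. **Proposition.** For all $k\geq 3$, $$\chi_M(F(2^{\Gamma_k}))=2k-1\qquad\text{and}\qquad \chi_M(F(2^{\Delta_k}))=k+1 .$$ -/

import Mathlib

open MeasureTheory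

namespace ShiftGraphs

/-- A marking of a group `Γ`: a finite symmetric generating set of `Γ` not containing the identity.
A marked group is a group together with a marking. -/
structure Marking (Γ : Type*) [Group Γ] where
  /-- the generating set -/
  gens : Set Γ
  finite_gens : gens.Finite
  inv_mem : ∀ s ∈ gens, s⁻¹ ∈ gens
  one_notMem : (1 : Γ) ∉ gens
  closure_gens : Subgroup.closure gens = ⊤

/-- The left shift action of `Γ` on `2^Γ`, `(g · x)(h) = x (g⁻¹ h)`. -/
def shift {Γ : Type*} [Group Γ] (g : Γ) (x : Γ → Bool) : Γ → Bool :=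
  fun h => x (g⁻¹ * h)

theorem shift_inv_shift {Γ : Type*} [Group Γ] (g : Γ) (x : Γ → Bool) :
    shift g⁻¹ (shift g x) = x := by
  funext h
  simp [shift]

/-- The free part `F(2^Γ)` of the left shift action. As a subset of `Γ → Bool` it carries the
subspace topology and the σ-algebra induced by the product σ-algebra; see the next instance. -/
def freePart (Γ : Type*) [Group Γ] : Set (Γ → Bool) :=
  {x | ∀ g : Γ, g ≠ 1 → shift g x ≠ x}

/-- For countable `Γ`, the σ-algebra on `F(2^Γ)` is the Borel σ-algebra of its topology. -/
instance freePart_borelSpace (Γ : Type*) [Group Γ] [Countable Γ] : BorelSpace (freePart Γ) :=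
  inferInstance

/-- The shift graph of a marked group: `x` and `y` in `F(2^Γ)` are adjacent
iff `s · x = y` for some generator `s`. -/
def shiftGraph {Γ : Type*} [Group Γ] (S : Marking Γ) : SimpleGraph (freePart Γ) where
  Adj x y := ∃ s ∈ S.gens, shift s (x : Γ → Bool) = y
  symm := ⟨by
    rintro x y ⟨s, hs, h⟩
    exact ⟨s⁻¹, S.inv_mem s hs, by rw [← h, shift_inv_shift]⟩⟩
  loopless := ⟨by
    rintro x ⟨s, hs, h⟩
    exact x.2 s (fun h1 => S.one_notMem (h1 ▸ hs)) h⟩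

/-- The `μ`-measurable chromatic number `χ_μ(G)`: the least `n` such that `G` has a proper
`n`-coloring which is `μ`-measurable, that is, measurable for the `μ`-completion of the σ-algebra
(and `⊤` if there is no such `n`). -/
noncomputable def measurableChromaticNumber {X : Type*} [MeasurableSpace X]
    (G : SimpleGraph X) (μ : Measure X) : ℕ∞ :=
  ⨅ n ∈ {n : ℕ | ∃ c : G.Coloring (Fin n), NullMeasurable (fun x => c x) μ}, (n : ℕ∞)

/-- The measure chromatic number `χ_M(G)`: the supremum of `χ_μ(G)` over all
probability measures `μ` on `X`. -/
noncomputable def measureChromaticNumber {X : Type*} [MeasurableSpace X]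
    (G : SimpleGraph X) : ℕ∞ :=
  ⨆ (μ : Measure X) (_ : IsProbabilityMeasure μ), measurableChromaticNumber G μ

/-- The group `Z_k × Z_k`, written multiplicatively. -/
abbrev Torus (k : ℕ) : Type := Multiplicative (ZMod k × ZMod k)

/-- The set `{(a, b) | a ≠ 0, b ≠ 0}` of generators of `Z_k × Z_k`. -/
def torusGens (k : ℕ) : Set (Torus k) :=
  {v | v.toAdd.1 ≠ 0 ∧ v.toAdd.2 ≠ 0}

/-- The subset `{-1, 0, 1}` of `ℤ`. -/
def steps : Set (Multiplicative ℤ) :=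
  {n | n.toAdd = -1 ∨ n.toAdd = 0 ∨ n.toAdd = 1}

/-- The automorphism `(a, b) ↦ (b, a)` of `Z_k × Z_k`. -/
def swapAut (k : ℕ) : MulAut (Torus k) :=
  AddEquiv.toMultiplicative (AddEquiv.prodComm (M := ZMod k) (N := ZMod k))

/-- The homomorphism `ℤ → Aut(Z_k × Z_k)` which sends `1` to the swap. -/
def swapHom (k : ℕ) : Multiplicative ℤ →* MulAut (Torus k) :=
  zpowersHom (MulAut (Torus k)) (swapAut k)

/-- The underlying group of `Δ_k`: the direct product `(Z_k × Z_k) × ℤ`. -/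
abbrev Delta (k : ℕ) : Type := Torus k × Multiplicative ℤ

/-- The underlying group of `Γ_k`: the semidirect product `(Z_k × Z_k) ⋊ ℤ`
in which `1 ∈ ℤ` acts by swapping the coordinates. -/
abbrev Gamma (k : ℕ) : Type := Torus k ⋊[swapHom k] Multiplicative ℤ

theorem swapHom_one (k : ℕ) : swapHom k (Multiplicative.ofAdd 1) = swapAut k := by
  simp [swapHom]

theorem swapAut_mem_torusGens {k : ℕ} {v : Torus k} (hv : v ∈ torusGens k) :
    swapAut k v ∈ torusGens k :=
  ⟨hv.2, hv.1⟩

theorem swapHom_mem_torusGens {k : ℕ} {n : Multiplicative ℤ} (hn : n ∈ steps)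
    {v : Torus k} (hv : v ∈ torusGens k) : swapHom k n v ∈ torusGens k := by
  have hs : swapAut k * swapAut k = 1 := by ext v <;> rfl
  rcases hn with h | h | h
  · obtain rfl : n = .ofAdd (-1) := h
    rw [ofAdd_neg, map_inv, swapHom_one, inv_eq_of_mul_eq_one_right hs]
    exact swapAut_mem_torusGens hv
  · obtain rfl : n = 1 := h
    simpa using hv
  · obtain rfl : n = .ofAdd 1 := h
    rw [swapHom_one]
    exact swapAut_mem_torusGens hv

theorem inv_mem_torusGens {k : ℕ} {v : Torus k} (hv : v ∈ torusGens k) : v⁻¹ ∈ torusGens k :=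
  ⟨neg_ne_zero.2 hv.1, neg_ne_zero.2 hv.2⟩

theorem inv_mem_steps {n : Multiplicative ℤ} (hn : n ∈ steps) : n⁻¹ ∈ steps := by
  simp only [steps, Set.mem_ofPred_eq, toAdd_inv] at *
  omega

theorem finite_steps : steps.Finite :=
  Set.Finite.subset (s := {.ofAdd (-1), .ofAdd 0, .ofAdd 1}) (by simp) fun _ h => h

theorem finite_torusGens {k : ℕ} (hk : 3 ≤ k) : (torusGens k).Finite := by
  have : NeZero k := ⟨by omega⟩
  have : Finite (Torus k) := inferInstanceAs (Finite (ZMod k × ZMod k))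
  exact Set.toFinite _

theorem closure_torusGens {k : ℕ} (hk : 3 ≤ k) : Subgroup.closure (torusGens k) = ⊤ := by
  have h1 : (1 : ZMod k) ≠ 0 := by
    have : Fact (1 < k) := ⟨by omega⟩
    exact one_ne_zero
  have h2 : (2 : ZMod k) ≠ 0 := by
    intro h
    have : ((2 : ℕ) : ZMod k) = 0 := by exact_mod_cast h
    rw [ZMod.natCast_eq_zero_iff] at this
    exact absurd (Nat.le_of_dvd (by norm_num) this) (by omega)
  have key : ∀ a : ZMod k, ∃ x y : ZMod k, x ≠ 0 ∧ y ≠ 0 ∧ x + y = a := by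
    intro a
    by_cases ha : a = 1
    · exact ⟨2, -1, h2, neg_ne_zero.2 h1, by rw [ha]; ring⟩
    · exact ⟨1, a - 1, h1, sub_ne_zero.2 ha, by ring⟩
  rw [eq_top_iff]
  rintro v -
  obtain ⟨x, y, hx, hy, hxy⟩ := key v.toAdd.1
  obtain ⟨z, w, hz, hw, hzw⟩ := key v.toAdd.2
  have : v = .ofAdd (x, z) * .ofAdd (y, w) := by
    apply Multiplicative.toAdd.injective
    exact Prod.ext hxy.symm hzw.symm
  rw [this]
  exact mul_mem (Subgroup.subset_closure ⟨hx, hz⟩) (Subgroup.subset_closure ⟨hy, hw⟩)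

/-- The marked group `Δ_k = (Z_k × Z_k) × ℤ` with generators `S × {-1, 0, 1}`,
where `S = {(a, b) | a ≠ 0, b ≠ 0}`. -/
def deltaMarking (k : ℕ) (hk : 3 ≤ k) : Marking (Delta k) where
  gens := {g | g.1 ∈ torusGens k ∧ g.2 ∈ steps}
  finite_gens := (finite_torusGens hk).prod finite_steps
  inv_mem := fun _ hs => ⟨inv_mem_torusGens hs.1, inv_mem_steps hs.2⟩
  one_notMem := fun h => h.1.1 rfl
  closure_gens := by
    set H := Subgroup.closure {g : Delta k | g.1 ∈ torusGens k ∧ g.2 ∈ steps} with hH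
    have hT : ∀ v : Torus k, ((v, 1) : Delta k) ∈ H := by
      have : Subgroup.closure (torusGens k) ≤ H.comap (MonoidHom.inl _ _) := by
        rw [Subgroup.closure_le]
        exact fun v hv => Subgroup.subset_closure ⟨hv, Or.inr (Or.inl rfl)⟩
      rw [closure_torusGens hk] at this
      exact fun v => this (Subgroup.mem_top v)
    have hs : ∃ v, v ∈ torusGens k := by
      have : Fact (1 < k) := ⟨by omega⟩
      exact ⟨.ofAdd (1, 1), one_ne_zero, one_ne_zero⟩
    obtain ⟨v, hv⟩ := hs
    have h1 : ((1, .ofAdd 1) : Delta k) ∈ H := by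
      have h : ((v, .ofAdd 1) : Delta k) ∈ H :=
        Subgroup.subset_closure ⟨hv, Or.inr (Or.inr rfl)⟩
      simpa using mul_mem (inv_mem (hT v)) h
    rw [eq_top_iff]
    rintro ⟨w, n⟩ -
    have h := mul_mem (hT w) (zpow_mem h1 n.toAdd)
    have e : ((w, 1) : Delta k) * (1, .ofAdd 1) ^ n.toAdd = (w, n) := by
      ext1
      · simp
      · simp [← ofAdd_zsmul]
    rwa [e] at h

/-- The marked group `Γ_k = (Z_k × Z_k) ⋊ ℤ` with generators `S × {-1, 0, 1}`,
where `S = {(a, b) | a ≠ 0, b ≠ 0}`. -/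
def gammaMarking (k : ℕ) (hk : 3 ≤ k) : Marking (Gamma k) where
  gens := {g | g.left ∈ torusGens k ∧ g.right ∈ steps}
  finite_gens :=
    ((finite_torusGens hk).prod finite_steps).preimage
      (f := fun g : Gamma k => (g.left, g.right))
      (fun a _ b _ h => SemidirectProduct.ext (congrArg Prod.fst h) (congrArg Prod.snd h))
  inv_mem := fun _ hs =>
    ⟨swapHom_mem_torusGens (inv_mem_steps hs.2) (inv_mem_torusGens hs.1), inv_mem_steps hs.2⟩
  one_notMem := fun h => h.1.1 rfl
  closure_gens := by
    set H := Subgroup.closure {g : Gamma k | g.left ∈ torusGens k ∧ g.right ∈ steps} with hH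
    have hT : ∀ v : Torus k, (SemidirectProduct.inl v : Gamma k) ∈ H := by
      have : Subgroup.closure (torusGens k) ≤ H.comap SemidirectProduct.inl := by
        rw [Subgroup.closure_le]
        exact fun v hv => Subgroup.subset_closure ⟨hv, Or.inr (Or.inl rfl)⟩
      rw [closure_torusGens hk] at this
      exact fun v => this (Subgroup.mem_top v)
    have hs : ∃ v, v ∈ torusGens k := by
      have : Fact (1 < k) := ⟨by omega⟩
      exact ⟨.ofAdd (1, 1), one_ne_zero, one_ne_zero⟩
    obtain ⟨v, hv⟩ := hs
    have h1 : (SemidirectProduct.inr (.ofAdd 1) : Gamma k) ∈ H := by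
      have h : (⟨v, .ofAdd 1⟩ : Gamma k) ∈ H :=
        Subgroup.subset_closure ⟨hv, Or.inr (Or.inr rfl)⟩
      rw [SemidirectProduct.mk_eq_inl_mul_inr] at h
      simpa using mul_mem (inv_mem (hT v)) h
    rw [eq_top_iff]
    rintro ⟨w, n⟩ -
    have h := mul_mem (hT w) (zpow_mem h1 n.toAdd)
    rw [← map_zpow, ← ofAdd_zsmul, smul_eq_mul, mul_one, ofAdd_toAdd] at h
    rwa [SemidirectProduct.mk_eq_inl_mul_inr]

end ShiftGraphs

/-!
Write `T = Z_k × Z_k`. A proper coloring of a free orbit is a sequence, indexed by `ℤ`, of proper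
colorings of the grid `T` in which consecutive terms are compatible: cells differing in both
coordinates never share a color.

For the upper bounds, a maximal independent set of markers is Borel and cuts every orbit into tiles
along `ℤ` of arbitrarily large but bounded length. On each marker the grid is colored by rows. The
coloring seen from the next marker is a translate, swapped if the group is `Γ_k` and the tile has
odd length, so a tile can be filled as soon as the two are joined by a walk of compatible grid
colorings. With `k + 1` colors the spare color allows us to permute the row colors by
transpositions. With `2k - 1` colors there is also a walk from rows to columns, through colorings
in which all columns but one have private colors.

For the lower bounds, an irrational rotation of the circle is mapped equivariantly into the free
part. With at most `k` colors, counting fibers shows that compatible grid colorings are equal, so a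
coloring for `Δ_k` is invariant under `(0, 1)`. Then it is also invariant under `(v, 1) ^ k` for
every `v`, and ergodicity of the `k`-th power of the rotation makes it constant along an edge.
With at most `2k - 2` colors, either every row or every column of a proper grid coloring repeats a
color, but not both, and compatible colorings agree on which. The action of `1 ∈ ℤ` in `Γ_k` swaps
the two cases, which contradicts ergodicity of the square of the rotation.
-/

namespace ShiftGraphs

section Markers

variable {Γ X : Type*} [Group Γ] [MulAction Γ X]

/-- A set is `K`-independent if no nontrivial element of `K` moves one of its points to another.
A maximal `K`-independent set serves as a set of markers. -/
def IsIndependent (K : Set Γ) (U : Set X) : Prop :=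
  ∀ x ∈ U, ∀ g ∈ K, g • x ∈ U → g = 1

/-- The greedy construction of a maximal `K`-independent set out of a sequence of `K`-independent
sets. -/
def greedy (K : Set Γ) (U : ℕ → Set X) : ℕ → Set X
  | 0 => ∅
  | n + 1 => greedy K U n ∪ {x | x ∈ U n ∧ ∀ g ∈ K, g • x ∉ greedy K U n}

variable {K : Set Γ} {U : ℕ → Set X}

theorem greedy_mono : Monotone (greedy K U) :=
  monotone_nat_of_le_succ fun _ => Set.subset_union_left

theorem isIndependent_greedy (hinv : ∀ g ∈ K, g⁻¹ ∈ K) (hU : ∀ n, IsIndependent K (U n)) (n : ℕ) :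
    IsIndependent K (greedy K U n) := by
  induction n with
  | zero => exact fun x hx => hx.elim
  | succ n ih =>
    rintro x (hx | hx) g hg (hgx | hgx)
    · exact ih x hx g hg hgx
    · exact absurd (by rwa [inv_smul_smul]) (hgx.2 g⁻¹ (hinv g hg))
    · exact absurd hgx (hx.2 g hg)
    · exact hU n x hx.1 g hg hgx.1

theorem isIndependent_iUnion_greedy (hinv : ∀ g ∈ K, g⁻¹ ∈ K) (hU : ∀ n, IsIndependent K (U n)) :
    IsIndependent K (⋃ n, greedy K U n) := by
  intro x hx g hg hgx
  obtain ⟨m, hm⟩ := Set.mem_iUnion.1 hx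
  obtain ⟨n, hn⟩ := Set.mem_iUnion.1 hgx
  exact isIndependent_greedy hinv hU (max m n) x (greedy_mono (le_max_left m n) hm) g hg
    (greedy_mono (le_max_right m n) hn)

theorem exists_smul_mem_iUnion_greedy (hone : (1 : Γ) ∈ K) {n : ℕ} {x : X} (hx : x ∈ U n) :
    ∃ g ∈ K, g • x ∈ ⋃ n, greedy K U n := by
  by_cases h : ∀ g ∈ K, g • x ∉ greedy K U n
  · exact ⟨1, hone, Set.mem_iUnion.2 ⟨n + 1, by rw [one_smul]; exact .inr ⟨hx, h⟩⟩⟩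
  · push Not at h
    obtain ⟨g, hg, hgx⟩ := h
    exact ⟨g, hg, Set.mem_iUnion.2 ⟨n, hgx⟩⟩

variable [MeasurableSpace X] [MeasurableConstSMul Γ X]

theorem measurableSet_greedy (hK : K.Finite) (hU : ∀ n, MeasurableSet (U n)) (n : ℕ) :
    MeasurableSet (greedy K U n) := by
  induction n with
  | zero => exact .empty
  | succ n ih =>
    have hfar : {x | x ∈ U n ∧ ∀ g ∈ K, g • x ∉ greedy K U n} =
        U n ∩ ⋂ g ∈ K, (g • ·) ⁻¹' (greedy K U n)ᶜ := by
      ext x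
      simp
    exact ih.union <| hfar ▸ (hU n).inter
      (hK.measurableSet_biInter fun g _ => measurable_const_smul g ih.compl)

variable [MeasurableSpace.CountablySeparated X]

theorem exists_seq_isIndependent (hK : K.Finite) (hfree : ∀ g ∈ K, g ≠ 1 → ∀ x : X, g • x ≠ x) :
    ∃ U : ℕ → Set X, (∀ n, MeasurableSet (U n)) ∧ (∀ n, IsIndependent K (U n)) ∧
      ∀ x, ∃ n, x ∈ U n := by
  have := hK.to_subtype
  obtain ⟨f, hfm, hf⟩ := MeasurableSpace.measurable_injection_nat_bool_of_countablySeparated X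
  obtain ⟨e, he⟩ := exists_surjective_nat (K → ℕ × Bool)
  let U (w : K → ℕ × Bool) : Set X :=
    {x | ∀ g : K, (g : Γ) ≠ 1 → f x (w g).1 = (w g).2 ∧ f ((g : Γ) • x) (w g).1 ≠ (w g).2}
  have hUm (w) : MeasurableSet (U w) := by
    have hb (n : ℕ) (b : Bool) : MeasurableSet {x | f x n = b} :=
      (measurable_pi_apply n).comp hfm (measurableSet_singleton b)
    simp only [U, Set.ofPred_forall]
    exact .iInter fun g => .iInter fun _ =>
      (hb _ _).inter (measurable_const_smul (g : Γ) (hb _ _)).compl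
  refine ⟨fun n => U (e n), fun n => hUm _, fun n x hx g hg hgx => ?_, fun x => ?_⟩
  · by_contra hg1
    exact (hx ⟨g, hg⟩ hg1).2 (hgx ⟨g, hg⟩ hg1).1
  · have hdiff : ∀ g : K, ∃ n, (g : Γ) ≠ 1 → f ((g : Γ) • x) n ≠ f x n := by
      intro g
      by_contra! h
      exact hfree g g.2 (h 0).1 x (hf (funext fun n => (h n).2))
    choose n hn using hdiff
    obtain ⟨m, hm⟩ := he fun g => (n g, f x (n g))
    exact ⟨m, by simp only [hm]; exact fun g hg => ⟨rfl, hn g hg⟩⟩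

theorem exists_maximal_isIndependent (hK : K.Finite) (hone : (1 : Γ) ∈ K)
    (hinv : ∀ g ∈ K, g⁻¹ ∈ K) (hfree : ∀ g ∈ K, g ≠ 1 → ∀ x : X, g • x ≠ x) :
    ∃ M : Set X, MeasurableSet M ∧ IsIndependent K M ∧ ∀ x, ∃ g ∈ K, g • x ∈ M := by
  obtain ⟨U, hUm, hU, hcover⟩ := exists_seq_isIndependent hK hfree
  refine ⟨_, .iUnion (measurableSet_greedy hK hUm), isIndependent_iUnion_greedy hinv hU,
    fun x => ?_⟩
  obtain ⟨n, hn⟩ := hcover x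
  exact exists_smul_mem_iUnion_greedy hone hn

end Markers

section Tiling

variable {Γ X C : Type*} [Group Γ] [MulAction Γ X] (π : Γ →* Multiplicative ℤ)

/-- The height of a group element: its image under a homomorphism to `ℤ`, as an integer. -/
def level (g : Γ) : ℤ := (π g).toAdd

@[simp] theorem level_one : level π (1 : Γ) = 0 := by simp [level]

@[simp] theorem level_mul (g h : Γ) : level π (g * h) = level π g + level π h := by simp [level]

@[simp] theorem level_inv (g : Γ) : level π g⁻¹ = -level π g := by simp [level]

theorem finite_abs_level_le [Finite π.ker] (L : ℤ) : {g | |level π g| ≤ L}.Finite := by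
  have hball : {n : Multiplicative ℤ | |n.toAdd| ≤ L}.Finite := by
    simp only [abs_le]
    exact (Set.finite_Icc (-L) L).preimage Multiplicative.toAdd.injective.injOn
  refine hball.preimage' fun n _ => ?_
  rcases (π ⁻¹' {n}).eq_empty_or_nonempty with h | ⟨g, rfl⟩
  · exact h ▸ Set.finite_empty
  · refine ((π.ker : Set Γ).toFinite.preimage (mul_right_injective g⁻¹).injOn).subset fun h hh => ?_
    have : π h = π g := hh
    simp [MonoidHom.mem_ker, this]

theorem countable_of_finite_ker [Finite π.ker] : Countable Γ := by
  have hcover : ⋃ L : ℤ, {g | |level π g| ≤ L} = Set.univ :=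
    Set.iUnion_eq_univ_iff.2 fun g => ⟨|level π g|, le_refl |level π g|⟩
  rw [← Set.countable_univ_iff, ← hcover]
  exact Set.countable_iUnion fun L => (finite_abs_level_le π L).countable

/-- A marker set for gaps `L`: any two markers on the same orbit are more than `L` levels apart,
and no point is more than `L` levels away from a marker. -/
structure IsMarkerSet (L : ℕ) (M : Set X) : Prop where
  isIndependent : IsIndependent {g | |level π g| ≤ L} M
  exists_smul_mem : ∀ x, ∃ g, |level π g| ≤ L ∧ g • x ∈ M

/-- `x` lies in the tile which begins at the marker `h⁻¹ • x` and ends before the next marker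
`(g * h⁻¹) • x`. -/
structure IsTiled (L : ℕ) (M : Set X) (x : X) (h g : Γ) : Prop where
  mem : h⁻¹ • x ∈ M
  next_mem : (g * h⁻¹) • x ∈ M
  nonneg : 0 ≤ level π h
  level_lt : level π h < level π g
  lt_level : L < level π g
  level_le : level π g ≤ 2 * L + 1

variable {π} {L : ℕ} {M : Set X}

theorem IsMarkerSet.eq_of_smul_mem (hM : IsMarkerSet π L M) {x : X} {a b : Γ} (ha : a • x ∈ M)
    (hb : b • x ∈ M) (hab : |level π a - level π b| ≤ L) : a = b := by
  refine mul_inv_eq_one.1 (hM.isIndependent _ hb _ ?_ ?_)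
  · simpa [sub_eq_add_neg] using hab
  · rwa [mul_smul, inv_smul_smul]

theorem IsTiled.eq_of_le (hM : IsMarkerSet π L M) {x : X} {h g h' g' : Γ}
    (H : IsTiled π L M x h g) (H' : IsTiled π L M x h' g') (hle : level π h' ≤ level π h) :
    h = h' ∧ g = g' := by
  obtain ⟨a1, a2, _, a4, a5, a6⟩ := H
  obtain ⟨b1, b2, b3, b4, b5, b6⟩ := H'
  by_cases hd : level π h - level π h' ≤ L
  · obtain rfl : h = h' := inv_injective <| hM.eq_of_smul_mem a1 b1 <| by
      simp only [level_inv, abs_le]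
      omega
    refine ⟨rfl, mul_right_cancel (hM.eq_of_smul_mem a2 b2 ?_)⟩
    simp only [level_mul, level_inv, abs_le]
    omega
  · have e : g * h⁻¹ = h'⁻¹ := hM.eq_of_smul_mem a2 b1 <| by
      simp only [level_mul, level_inv, abs_le]
      omega
    have := congrArg (level π) e
    simp only [level_mul, level_inv] at this
    omega

theorem IsTiled.unique (hM : IsMarkerSet π L M) {x : X} {h g h' g' : Γ}
    (H : IsTiled π L M x h g) (H' : IsTiled π L M x h' g') : h = h' ∧ g = g' := by
  rcases le_total (level π h') (level π h) with hle | hle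
  · exact H.eq_of_le hM H' hle
  · exact (H'.eq_of_le hM H hle).imp Eq.symm Eq.symm

theorem IsMarkerSet.exists_next (hM : IsMarkerSet π L M) (hπ : Function.Surjective π) {x : X}
    {a : Γ} (ha : a • x ∈ M) :
    ∃ g, (g * a) • x ∈ M ∧ L < level π g ∧ level π g ≤ 2 * L + 1 := by
  obtain ⟨t, ht⟩ := hπ (.ofAdd (L + 1))
  have ht : level π t = L + 1 := congrArg Multiplicative.toAdd ht
  obtain ⟨g, hg, hgx⟩ := hM.exists_smul_mem (t • a • x)
  rw [← mul_smul, ← mul_smul] at hgx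
  rw [abs_le] at hg
  refine ⟨g * t, hgx, ?_, by rw [level_mul]; omega⟩
  by_contra hlt
  rw [level_mul] at hlt
  have e : g * t * a = a := hM.eq_of_smul_mem hgx ha <| by
    simp only [level_mul, abs_le]
    omega
  have := congrArg (level π) e
  simp only [level_mul] at this
  omega

theorem IsMarkerSet.exists_isTiled (hM : IsMarkerSet π L M) (hπ : Function.Surjective π) (x : X) :
    ∃ h g, IsTiled π L M x h g := by
  obtain ⟨r, hr⟩ := hπ (.ofAdd L)
  have hr : level π r = L := congrArg Multiplicative.toAdd hr
  obtain ⟨u, hu, hux⟩ := hM.exists_smul_mem (r⁻¹ • x)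
  rw [← mul_smul] at hux
  rw [abs_le] at hu
  have hw : level π (u * r⁻¹) = level π u - L := by simp [hr, sub_eq_add_neg]
  obtain ⟨g, hg, hg1, hg2⟩ := hM.exists_next hπ hux
  by_cases hpos : 0 < level π (g * (u * r⁻¹))
  · rw [level_mul] at hpos
    exact ⟨(u * r⁻¹)⁻¹, g, by rwa [inv_inv], by rwa [inv_inv], by rw [level_inv]; omega,
      by rw [level_inv]; omega, hg1, hg2⟩
  · rw [level_mul] at hpos
    obtain ⟨g', hg', hg1', hg2'⟩ := hM.exists_next hπ hg
    exact ⟨(g * (u * r⁻¹))⁻¹, g', by rwa [inv_inv], by rwa [inv_inv],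
      by rw [level_inv, level_mul]; omega, by rw [level_inv, level_mul]; omega, hg1', hg2'⟩

variable (π) in
/-- A proper coloring `P` of the left Cayley graph of `(Γ, S)` which carries the coloring `σ` of
the kernel of `π` to its right translate by `g`. Only the values of `σ` on the kernel matter. -/
structure IsTransition (S : Set Γ) (σ : Γ → C) (g : Γ) (P : Γ → C) : Prop where
  proper : ∀ s ∈ S, ∀ h, P h ≠ P (s * h)
  eq_start : ∀ h, level π h = 0 → P h = σ h
  eq_end : ∀ h, level π h = 0 → P (h * g) = σ h

theorem IsTiled.smul_of_lt {x : X} {h g s : Γ} (H : IsTiled π L M x h g) (hs : 0 ≤ level π s)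
    (hlt : level π (s * h) < level π g) : IsTiled π L M (s • x) (s * h) g where
  mem := by simpa [mul_smul] using H.mem
  next_mem := by simpa [mul_smul] using H.next_mem
  nonneg := by rw [level_mul]; exact add_nonneg hs H.nonneg
  level_lt := hlt
  lt_level := H.lt_level
  level_le := H.level_le

theorem IsMarkerSet.exists_isTiled_smul (hM : IsMarkerSet π L M) (hπ : Function.Surjective π)
    {x : X} {h g s : Γ} (H : IsTiled π L M x h g) (hs : level π (s * h) = level π g) :
    ∃ g', IsTiled π L M (s • x) (s * h * g⁻¹) g' := by
  obtain ⟨g', hg', hlt, hle⟩ := hM.exists_next hπ H.next_mem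
  have h0 : level π (s * h * g⁻¹) = 0 := by rw [level_mul, level_inv, hs, add_neg_cancel]
  exact ⟨g', by simpa [mul_smul] using H.next_mem, by simpa [mul_smul] using hg', h0.ge,
    by omega, hlt, hle⟩

/-- The colorings `P g` of the tiles match along the markers. -/
theorem IsTiled.ne_smul (hM : IsMarkerSet π L M) (hπ : Function.Surjective π) {S : Set Γ}
    {σ : Γ → C} {P : Γ → Γ → C} (hP : ∀ g, L < level π g → IsTransition π S σ g (P g))
    {c : X → C} (hc : ∀ {x h g}, IsTiled π L M x h g → c x = P g h) {s : Γ} (hs : s ∈ S)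
    (h0 : 0 ≤ level π s) (h1 : level π s ≤ 1) {x : X} {h g : Γ} (H : IsTiled π L M x h g) :
    c x ≠ c (s • x) := by
  have hproper := (hP g H.lt_level).proper s hs h
  by_cases hlt : level π (s * h) < level π g
  · rwa [hc H, hc (H.smul_of_lt h0 hlt)]
  · have heq : level π (s * h) = level π g := by
      have := H.level_lt
      rw [level_mul] at hlt ⊢
      omega
    have hker : level π (s * h * g⁻¹) = 0 := by rw [level_mul, level_inv, heq, add_neg_cancel]
    obtain ⟨g', H'⟩ := hM.exists_isTiled_smul hπ H heq
    rwa [hc H, hc H', (hP g' H'.lt_level).eq_start _ hker, ← (hP g H.lt_level).eq_end _ hker,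
      inv_mul_cancel_right]

section Measurable

variable [MeasurableSpace X] [MeasurableConstSMul Γ X]

theorem measurableSet_isTiled (hM : MeasurableSet M) (h g : Γ) :
    MeasurableSet {x | IsTiled π L M x h g} := by
  have hset : {x | IsTiled π L M x h g} = ((h⁻¹ • ·) ⁻¹' M ∩ ((g * h⁻¹) • ·) ⁻¹' M) ∩
      {_x | 0 ≤ level π h ∧ level π h < level π g ∧ L < level π g ∧ level π g ≤ 2 * L + 1} := by
    ext x
    exact ⟨fun ⟨h1, h2, h3, h4, h5, h6⟩ => ⟨⟨h1, h2⟩, h3, h4, h5, h6⟩,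
      fun ⟨⟨h1, h2⟩, h3, h4, h5, h6⟩ => ⟨h1, h2, h3, h4, h5, h6⟩⟩
  rw [hset]
  exact ((measurable_const_smul h⁻¹ hM).inter (measurable_const_smul (g * h⁻¹) hM)).inter
    (.const _)

variable [MeasurableSpace.CountablySeparated X]

theorem exists_isMarkerSet [Finite π.ker] (hfree : ∀ g : Γ, g ≠ 1 → ∀ x : X, g • x ≠ x) (L : ℕ) :
    ∃ M : Set X, MeasurableSet M ∧ IsMarkerSet π L M := by
  obtain ⟨M, hMm, hM, hmax⟩ := exists_maximal_isIndependent (X := X) (finite_abs_level_le π L)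
    (by simp) (fun g hg => by simpa using hg) fun g _ => hfree g
  exact ⟨M, hMm, hM, hmax⟩

theorem exists_measurable_coloring_of_isTransition [Finite π.ker] (hπ : Function.Surjective π)
    (hfree : ∀ g : Γ, g ≠ 1 → ∀ x : X, g • x ≠ x) {S : Set Γ} (hinv : ∀ s ∈ S, s⁻¹ ∈ S)
    (hS : ∀ s ∈ S, |level π s| ≤ 1) {σ : Γ → C}
    (hσ : ∀ g, L < level π g → ∃ P, IsTransition π S σ g P) :
    ∃ c : X → C, (∀ d, MeasurableSet (c ⁻¹' {d})) ∧ ∀ s ∈ S, ∀ x, c x ≠ c (s • x) := by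
  have := countable_of_finite_ker π
  obtain ⟨M, hMm, hM⟩ := exists_isMarkerSet (π := π) hfree L
  have : Nonempty C := ⟨σ 1⟩
  choose! P hP using hσ
  choose h g hhg using hM.exists_isTiled hπ
  let c (x : X) : C := P (g x) (h x)
  have hc {x h' g'} (H : IsTiled π L M x h' g') : c x = P g' h' := by
    obtain ⟨rfl, rfl⟩ := (hhg x).unique hM H
    rfl
  refine ⟨c, fun d => ?_, fun s hs x => ?_⟩
  · have hfib : c ⁻¹' {d} = ⋃ (h') (g') (_ : P g' h' = d), {x | IsTiled π L M x h' g'} := by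
      ext x
      simp only [Set.mem_preimage, Set.mem_singleton_iff, Set.mem_iUnion, Set.mem_ofPred_eq,
        exists_prop]
      exact ⟨fun hx => ⟨h x, g x, hx, hhg x⟩, fun ⟨_, _, hd, H⟩ => (hc H).trans hd⟩
    rw [hfib]
    exact .iUnion fun h' => .iUnion fun g' => .iUnion fun _ => measurableSet_isTiled hMm h' g'
  · obtain ⟨hle, hge⟩ := abs_le.1 (hS s hs)
    rcases le_total 0 (level π s) with h0 | h0
    · exact (hhg x).ne_smul hM hπ hP hc hs h0 hge
    · have := (hhg (s • x)).ne_smul hM hπ hP hc (hinv s hs) (by rw [level_inv]; omega)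
        (by rw [level_inv]; omega)
      rw [inv_smul_smul] at this
      exact this.symm

end Measurable

end Tiling

section Walks

variable {A : Type*} {R : A → A → Prop}

/-- A step of a walk in `R` which is allowed to pause at its end point. -/
def LoopStep (R : A → A → Prop) (x y : A) : Prop := R x y ∧ R y y

/-- An infinite walk in `R` which starts at `a`, may pause at each of its points, and has reached
`b` for good at time `L`. -/
structure IsWalk (R : A → A → Prop) (a b : A) (L : ℕ) (f : ℕ → A) : Prop where
  zero : f 0 = a
  rel_self : ∀ n, R (f n) (f n)
  rel_succ : ∀ n, R (f n) (f (n + 1))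
  eq_end : ∀ n, L ≤ n → f n = b

theorem exists_isWalk {a b : A} (ha : R a a) (h : Relation.ReflTransGen (LoopStep R) a b) :
    ∃ L f, IsWalk R a b L f := by
  induction h using Relation.ReflTransGen.head_induction_on with
  | refl => exact ⟨0, fun _ => b, rfl, fun _ => ha, fun _ => ha, fun _ _ => rfl⟩
  | @head x y hxy _ ih =>
    obtain ⟨L, f, hf⟩ := ih hxy.2
    refine ⟨L + 1, fun n => Nat.casesOn n x f, rfl, ?_, ?_, ?_⟩
    · rintro (_ | n)
      exacts [ha, hf.rel_self n]
    · rintro (_ | n)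
      exacts [show R x (f 0) from hf.zero ▸ hxy.1, hf.rel_succ n]
    · rintro (_ | n) hn
      exacts [absurd hn (by omega), hf.eq_end n (by omega)]

theorem IsWalk.mono {a b : A} {L M : ℕ} {f : ℕ → A} (hf : IsWalk R a b L f) (h : L ≤ M) :
    IsWalk R a b M f :=
  { hf with eq_end := fun n hn => hf.eq_end n (h.trans hn) }

theorem exists_isWalk_uniform [Finite A] {a : A} (ha : R a a) :
    ∃ L, ∀ b, Relation.ReflTransGen (LoopStep R) a b → ∃ f, IsWalk R a b L f := by
  have hlong : ∀ b, ∀ᶠ L in Filter.atTop,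
      Relation.ReflTransGen (LoopStep R) a b → ∃ f, IsWalk R a b L f := by
    intro b
    by_cases h : Relation.ReflTransGen (LoopStep R) a b
    · obtain ⟨L, f, hf⟩ := exists_isWalk ha h
      filter_upwards [Filter.eventually_ge_atTop L] with M hM _ using ⟨f, hf.mono hM⟩
    · exact .of_forall fun _ h' => absurd h' h
  exact (Filter.eventually_all.2 hlong).exists

theorem IsWalk.rel_toNat {a b : A} {L : ℕ} {f : ℕ → A} (hf : IsWalk R a b L f)
    (hsymm : ∀ x y, R x y → R y x) {m n : ℤ} (hmn : |m - n| ≤ 1) : R (f n.toNat) (f m.toNat) := by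
  rw [abs_le] at hmn
  obtain e | e | e :
      m.toNat = n.toNat ∨ m.toNat = n.toNat + 1 ∨ n.toNat = m.toNat + 1 := by omega
  · exact e ▸ hf.rel_self _
  · exact e ▸ hf.rel_succ _
  · exact e ▸ hsymm _ _ (hf.rel_succ _)

end Walks

section SemidirectProduct

variable {N C : Type*} [Group N]

/-- The coloring `G` of a level and the coloring `H` of an adjacent (or the same) level give
different colors to `v` and `s * v` for every `s ∈ T`. -/
def CayleyCompatible (T : Set N) (G H : N → C) : Prop :=
  ∀ s ∈ T, ∀ v, G v ≠ H (s * v)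

variable {T : Set N} (hinv : ∀ s ∈ T, s⁻¹ ∈ T)

include hinv in
theorem CayleyCompatible.symm {G H : N → C} (h : CayleyCompatible T G H) :
    CayleyCompatible T H G :=
  fun s hs v e => h s⁻¹ (hinv s hs) (s * v) (by rw [inv_mul_cancel_left, e])

theorem abs_toAdd_le_one {n : Multiplicative ℤ} (hn : n ∈ steps) : |n.toAdd| ≤ 1 := by
  rcases hn with h | h | h <;> simp [h]

variable {φ : Multiplicative ℤ →* MulAut N}

theorem inv_apply_mul_left (s h : N ⋊[φ] Multiplicative ℤ) :
    (φ (s * h).right)⁻¹ (s * h).left =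
      φ (h.right⁻¹ * s.right⁻¹) s.left * (φ h.right)⁻¹ h.left := by
  rw [SemidirectProduct.mul_right, SemidirectProduct.mul_left, ← map_inv, mul_inv_rev,
    map_mul (φ _), ← map_inv, map_mul φ, MulAut.mul_apply, MulAut.mul_apply, map_inv, map_inv,
    MulAut.inv_apply_self]

variable (hφ : ∀ n, ∀ s ∈ T, φ n s ∈ T)

/-- The set `T × {-1, 0, 1}` of generators of `N ⋊ ℤ`. -/
def stepGens (φ : Multiplicative ℤ →* MulAut N) (T : Set N) : Set (N ⋊[φ] Multiplicative ℤ) :=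
  {s | s.left ∈ T ∧ s.right ∈ steps}

include hinv hφ in
theorem inv_mem_stepGens {s : N ⋊[φ] Multiplicative ℤ} (hs : s ∈ stepGens φ T) :
    s⁻¹ ∈ stepGens φ T :=
  ⟨hφ _ _ (hinv _ hs.1), inv_mem_steps hs.2⟩

include hinv hφ in
/-- In the coordinates `(φ h.right)⁻¹ h.left`, left multiplication by a generator changes the level
by at most one and multiplies the coordinate by an element of `T`. -/
theorem IsWalk.isTransition {σ : N → C} {L : ℕ} {f : ℕ → N → C} {g : N ⋊[φ] Multiplicative ℤ}
    (hf : IsWalk (CayleyCompatible T) σ (fun v => σ (φ g.right v * g.left⁻¹)) L f)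
    (hg : L < level SemidirectProduct.rightHom g) :
    IsTransition SemidirectProduct.rightHom (stepGens φ T) (fun h => σ h.left) g
      fun h => f h.right.toAdd.toNat ((φ h.right)⁻¹ h.left) where
  proper s hs h := by
    have hstep : |(s * h).right.toAdd - h.right.toAdd| ≤ 1 := by
      simpa using abs_toAdd_le_one hs.2
    rw [inv_apply_mul_left]
    exact hf.rel_toNat (fun _ _ => .symm hinv) hstep _ (hφ _ _ hs.1) _
  eq_start h h0 := by
    have hone : h.right = 1 := h0
    simp [hone, hf.zero]
  eq_end h h0 := by
    have hone : h.right = 1 := h0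
    have hlarge : L ≤ g.right.toAdd.toNat := by
      have : (L : ℤ) < g.right.toAdd := hg
      omega
    simp [hone, hf.eq_end _ hlarge]

variable {X : Type*} [MulAction (N ⋊[φ] Multiplicative ℤ) X] [MeasurableSpace X]
  [MeasurableSpace.CountablySeparated X] [MeasurableConstSMul (N ⋊[φ] Multiplicative ℤ) X]

theorem finite_ker_rightHom [Finite N] :
    Finite (SemidirectProduct.rightHom : N ⋊[φ] Multiplicative ℤ →* _).ker := by
  rw [← SemidirectProduct.range_inl_eq_ker_rightHom]
  exact Set.finite_range _

include hinv hφ in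
theorem exists_measurable_coloring_of_reflTransGen [Finite N] [Finite C]
    (hfree : ∀ g : N ⋊[φ] Multiplicative ℤ, g ≠ 1 → ∀ x : X, g • x ≠ x) {σ : N → C}
    (hσ : CayleyCompatible T σ σ)
    (hreach : ∀ n u, Relation.ReflTransGen (LoopStep (CayleyCompatible T)) σ
      fun v => σ (φ n v * u)) :
    ∃ c : X → C, (∀ d, MeasurableSet (c ⁻¹' {d})) ∧ ∀ s ∈ stepGens φ T, ∀ x, c x ≠ c (s • x) := by
  have := finite_ker_rightHom (φ := φ)
  obtain ⟨L, hL⟩ := exists_isWalk_uniform hσ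
  refine exists_measurable_coloring_of_isTransition (L := L) (σ := fun h => σ h.left)
    SemidirectProduct.rightHom_surjective hfree (fun s => inv_mem_stepGens hinv hφ)
    (fun s hs => abs_toAdd_le_one hs.2) fun g hg => ?_
  obtain ⟨f, hf⟩ := hL _ (hreach g.right g.left⁻¹)
  exact ⟨_, hf.isTransition hinv hφ hg⟩

end SemidirectProduct

section ChromaticNumber

variable {X : Type*} [MeasurableSpace X] {G : SimpleGraph X}

theorem measureChromaticNumber_le {C : Type*} [Finite C] (c : G.Coloring C)
    (hc : ∀ d, MeasurableSet (c ⁻¹' {d})) : measureChromaticNumber G ≤ Nat.card C := by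
  let e := Finite.equivFin C
  have hm : Measurable fun x => e (c x) := by
    refine measurable_to_countable' fun i => ?_
    convert hc (e.symm i) using 1
    ext x
    simp [Equiv.eq_symm_apply]
  refine iSup₂_le fun μ _ => iInf₂_le_of_le (Nat.card C) ?_ le_rfl
  exact ⟨.mk (fun x => e (c x)) fun h he => c.valid h (e.injective he), hm.nullMeasurable⟩

theorem exists_isProbabilityMeasure_absolutelyContinuous {ι : Type*} [Countable ι] [Nonempty ι]
    (μ : ι → Measure X) [∀ i, IsProbabilityMeasure (μ i)] :
    ∃ ν : Measure X, IsProbabilityMeasure ν ∧ ∀ i, μ i ≪ ν := by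
  have : NeZero (Measure.sum μ) := by
    obtain ⟨i⟩ := ‹Nonempty ι›
    exact ⟨fun h => NeZero.ne (μ i) (Measure.sum_eq_zero.1 h i)⟩
  exact ⟨(Measure.sum μ).toFinite, inferInstance, fun i =>
    (Measure.absolutelyContinuous_sum_right i .rfl).trans (absolutelyContinuous_toFinite _)⟩

theorem le_measureChromaticNumber {ι Y : Type*} [Countable ι] [Nonempty ι] [MeasurableSpace Y]
    (μ : Measure Y) [IsProbabilityMeasure μ] {q : ι → Y → X} (hq : ∀ i, Measurable (q i)) {n : ℕ}
    (h : ∀ m < n, ∀ c : G.Coloring (Fin m), ¬ ∀ i, NullMeasurable (fun y => c (q i y)) μ) :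
    (n : ℕ∞) ≤ measureChromaticNumber G := by
  have hprob (i : ι) : IsProbabilityMeasure (μ.map (q i)) :=
    Measure.isProbabilityMeasure_map (hq i).aemeasurable
  obtain ⟨ν, hν, hac⟩ := exists_isProbabilityMeasure_absolutelyContinuous fun i => μ.map (q i)
  refine le_iSup₂_of_le ν hν (le_iInf₂ ?_)
  rintro m ⟨c, hc⟩
  by_contra hlt
  exact h m (by exact_mod_cast not_le.1 hlt) c fun i =>
    hc.comp_quasiMeasurePreserving ⟨hq i, hac i⟩

end ChromaticNumber

section FreePart

variable {Γ : Type*} [Group Γ]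

theorem shift_one (x : Γ → Bool) : shift 1 x = x := by
  funext h
  simp [shift]

theorem shift_mul (g h : Γ) (x : Γ → Bool) : shift (g * h) x = shift g (shift h x) := by
  funext u
  simp [shift, mul_assoc]

theorem shift_mem_freePart (g : Γ) {x : Γ → Bool} (hx : x ∈ freePart Γ) :
    shift g x ∈ freePart Γ := by
  intro u hu h
  refine hx (g⁻¹ * u * g) (fun h1 => hu ?_) ?_
  · rwa [mul_assoc, inv_mul_eq_one, eq_comm, mul_eq_right] at h1
  · rw [shift_mul, shift_mul, h, shift_inv_shift]

/-- The shift action of `Γ` on the free part. -/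
instance freePartAction : MulAction Γ (freePart Γ) where
  smul g x := ⟨shift g x, shift_mem_freePart g x.2⟩
  one_smul _ := Subtype.ext (shift_one _)
  mul_smul g h _ := Subtype.ext (shift_mul g h _)

theorem smul_freePart_ne {g : Γ} (hg : g ≠ 1) (x : freePart Γ) : g • x ≠ x :=
  fun h => x.2 g hg (congrArg Subtype.val h)

instance freePart_measurableConstSMul : MeasurableConstSMul Γ (freePart Γ) where
  measurable_const_smul g := Measurable.subtype_mk (f := fun x : freePart Γ => shift g x) <|
    measurable_pi_iff.2 fun h => (measurable_pi_apply (g⁻¹ * h)).comp measurable_subtype_coe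

variable {S : Marking Γ} {C : Type*}

theorem shiftGraph_adj_smul {s : Γ} (hs : s ∈ S.gens) (x : freePart Γ) :
    (shiftGraph S).Adj x (s • x) :=
  ⟨s, hs, rfl⟩

theorem measureChromaticNumber_shiftGraph_le [Finite C] {c : freePart Γ → C}
    (hc : ∀ d, MeasurableSet (c ⁻¹' {d})) (hS : ∀ s ∈ S.gens, ∀ x, c x ≠ c (s • x)) :
    measureChromaticNumber (shiftGraph S) ≤ Nat.card C := by
  refine measureChromaticNumber_le (.mk c ?_) hc
  rintro x y ⟨s, hs, hxy⟩
  exact (Subtype.ext hxy : s • x = y) ▸ hS s hs x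

end FreePart

section Grid

variable {α β C : Type*} {G H : α × β → C}

/-- Two colorings of the grid `α × β` are compatible if a common color only ever appears at cells
which lie on a common row or column. -/
def GridCompatible (G H : α × β → C) : Prop :=
  ∀ v w, v.1 ≠ w.1 → v.2 ≠ w.2 → G v ≠ H w

theorem GridCompatible.symm (h : GridCompatible G H) : GridCompatible H G :=
  fun v w h1 h2 e => h w v h1.symm h2.symm e.symm

theorem GridCompatible.comp_swap (h : GridCompatible G H) :
    GridCompatible (G ∘ Prod.swap) (H ∘ Prod.swap) :=
  fun v w h1 h2 => h v.swap w.swap h2 h1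

theorem GridCompatible.fst_eq_or_snd_eq (h : GridCompatible G H) {v w : α × β} (e : G v = H w) :
    v.1 = w.1 ∨ v.2 = w.2 := by
  by_contra! hne
  exact h v w hne.1 hne.2 e

theorem GridCompatible.fst_eq_of_repeated (h : GridCompatible G H) {i : α} {j j' : β} (hj : j ≠ j')
    (e : G (i, j) = G (i, j')) {w : α × β} (hw : G (i, j) = H w) : i = w.1 := by
  rcases h.fst_eq_or_snd_eq hw, h.fst_eq_or_snd_eq (e.symm.trans hw) with ⟨h1 | h1, h2 | h2⟩
  exacts [h1, h1, h2, absurd (h1.trans h2.symm) hj]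

/-- Every row has a repeated color. -/
def NoRainbowRow (G : α × β → C) : Prop :=
  ∀ i, ¬ Function.Injective fun j => G (i, j)

theorem NoRainbowRow.exists_repeated (h : NoRainbowRow G) (i : α) :
    ∃ j j', j ≠ j' ∧ G (i, j) = G (i, j') := by
  obtain ⟨j, j', e, hj⟩ := Function.not_injective_iff.1 (h i)
  exact ⟨j, j', hj, e⟩

theorem subset_row_or_subset_column {D : Finset (α × β)} {v : α × β} (hv : v ∈ D)
    (hD : ∀ v ∈ D, ∀ w ∈ D, v.1 = w.1 ∨ v.2 = w.2) :
    (∀ w ∈ D, w.1 = v.1) ∨ ∀ w ∈ D, w.2 = v.2 := by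
  by_contra! ⟨⟨w, hw, hw1⟩, ⟨u, hu, hu2⟩⟩
  have h1 := hD v hv w hw
  have h2 := hD v hv u hu
  have h3 := hD w hw u hu
  grind

theorem card_le_max_of_common_line [Fintype α] [Fintype β] {D : Finset (α × β)}
    (hD : ∀ v ∈ D, ∀ w ∈ D, v.1 = w.1 ∨ v.2 = w.2) :
    D.card ≤ max (Fintype.card α) (Fintype.card β) := by
  rcases D.eq_empty_or_nonempty with rfl | ⟨v, hv⟩
  · simp
  rcases subset_row_or_subset_column hv hD with h | h
  · refine le_max_of_le_right (Finset.card_le_card_of_injOn Prod.snd (by simp) ?_)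
    exact fun x hx y hy e => Prod.ext ((h x hx).trans (h y hy).symm) e
  · refine le_max_of_le_left (Finset.card_le_card_of_injOn Prod.fst (by simp) ?_)
    exact fun x hx y hy e => Prod.ext e ((h x hx).trans (h y hy).symm)

section Card

variable [Fintype α] [Fintype β] [Fintype C]

theorem noRainbowRow_or_noRainbowRow_comp_swap (hG : GridCompatible G G)
    (hC : Fintype.card C + 1 < Fintype.card α + Fintype.card β) :
    NoRainbowRow G ∨ NoRainbowRow (G ∘ Prod.swap) := by
  classical
  by_contra! hne
  simp only [NoRainbowRow, not_forall, not_not] at hne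
  obtain ⟨⟨i, hi⟩, ⟨j, hj⟩⟩ := hne
  have hmix (b : β) (a : {a // a ≠ i}) : G (i, b) ≠ G (a, j) := by
    intro e
    rcases hG.fst_eq_or_snd_eq e with h | rfl
    · exact a.2 h.symm
    · exact a.2 (hj e.symm)
  have := Fintype.card_le_of_injective
    (Sum.elim (fun b => G (i, b)) fun a : {a // a ≠ i} => G (a, j))
    (Function.Injective.sumElim hi (hj.comp Subtype.val_injective) hmix)
  rw [Fintype.card_sum, Fintype.card_subtype_compl, Fintype.card_subtype_eq] at this
  omega

theorem NoRainbowRow.not_comp_swap (hG : GridCompatible G G) (hH : GridCompatible H H)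
    (hGH : GridCompatible G H) (hC : Fintype.card C < Fintype.card α + Fintype.card β)
    (h : NoRainbowRow G) : ¬ NoRainbowRow (H ∘ Prod.swap) := by
  intro h'
  choose a b hab ha using h.exists_repeated
  choose p q hpq hp using h'.exists_repeated
  have hmix (i : α) (j : β) : G (i, a i) ≠ H (p j, j) := fun e =>
    hpq j ((hGH.fst_eq_of_repeated (hab i) (ha i) e).symm.trans
      (hGH.fst_eq_of_repeated (hab i) (ha i) (e.trans (hp j))))
  have hrow : Function.Injective fun i => G (i, a i) := fun i i' e =>
    hG.fst_eq_of_repeated (hab i) (ha i) (w := (i', a i')) e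
  have hcol : Function.Injective fun j => H (p j, j) := fun j j' e =>
    hH.comp_swap.fst_eq_of_repeated (hpq j) (hp j) (w := (j', p j')) e
  have := Fintype.card_le_of_injective _ (hrow.sumElim hcol hmix)
  rw [Fintype.card_sum] at this
  omega

theorem noRainbowRow_comp_swap_iff (hG : GridCompatible G G)
    (hC : Fintype.card C + 1 < Fintype.card α + Fintype.card β) :
    NoRainbowRow (G ∘ Prod.swap) ↔ ¬ NoRainbowRow G :=
  ⟨fun h h' => h'.not_comp_swap hG hG hG (by omega) h,
    (noRainbowRow_or_noRainbowRow_comp_swap hG hC).resolve_left⟩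

theorem GridCompatible.noRainbowRow_iff (hG : GridCompatible G G) (hH : GridCompatible H H)
    (hGH : GridCompatible G H) (hC : Fintype.card C + 1 < Fintype.card α + Fintype.card β) :
    NoRainbowRow G ↔ NoRainbowRow H := by
  have (h : NoRainbowRow G) := h.not_comp_swap hG hH hGH (by omega)
  have (h : NoRainbowRow H) := h.not_comp_swap hH hG hGH.symm (by omega)
  have := noRainbowRow_comp_swap_iff hG hC
  have := noRainbowRow_comp_swap_iff hH hC
  tauto

/-- The fibers of `G` already exhaust the sets `{v | G v = d ∨ H v = d}`. -/
theorem eq_of_card_union_fiber_le {V : Type*} [Fintype V] [DecidableEq C] {G H : V → C} {m : ℕ}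
    (hm : ∀ d, (Finset.univ.filter fun v => G v = d ∨ H v = d).card ≤ m)
    (hC : Fintype.card C * m ≤ Fintype.card V) : G = H := by
  let D (d : C) := Finset.univ.filter fun v => G v = d ∨ H v = d
  let F (d : C) := Finset.univ.filter fun v => G v = d
  have hFD (d : C) : F d ⊆ D d := Finset.monotone_filter_right _ fun _ _ => .inl
  have hsum : ∑ d, (D d).card ≤ ∑ d, (F d).card := calc
    ∑ d, (D d).card ≤ Fintype.card C * m := Finset.sum_le_card_nsmul _ _ _ fun d _ => hm d
    _ ≤ Fintype.card V := hC
    _ = ∑ d, (F d).card := Finset.card_eq_sum_card_fiberwise fun _ _ => Finset.mem_univ _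
  have hcard (d : C) : (F d).card = (D d).card :=
    (Finset.sum_eq_sum_iff_of_le fun d _ => Finset.card_le_card (hFD d)).1
      (le_antisymm (Finset.sum_le_sum fun d _ => Finset.card_le_card (hFD d)) hsum)
      d (Finset.mem_univ d)
  funext v
  have hv : v ∈ F (H v) := by
    rw [Finset.eq_of_subset_of_card_le (hFD _) (hcard _).ge]
    simp [D]
  simpa [F] using hv

theorem GridCompatible.eq (hG : GridCompatible G G) (hH : GridCompatible H H)
    (hGH : GridCompatible G H) (hα : Fintype.card C ≤ Fintype.card α)
    (hβ : Fintype.card C ≤ Fintype.card β) : G = H := by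
  classical
  refine eq_of_card_union_fiber_le (m := max (Fintype.card α) (Fintype.card β))
    (fun d => card_le_max_of_common_line fun v hv w hw => ?_) ?_
  · simp only [Finset.mem_filter, Finset.mem_univ, true_and] at hv hw
    rcases hv, hw with ⟨hv | hv, hw | hw⟩
    · exact hG.fst_eq_or_snd_eq (hv.trans hw.symm)
    · exact hGH.fst_eq_or_snd_eq (hv.trans hw.symm)
    · exact hGH.symm.fst_eq_or_snd_eq (hv.trans hw.symm)
    · exact hH.fst_eq_or_snd_eq (hv.trans hw.symm)
  · rw [Fintype.card_prod, ← max_mul_min (Fintype.card α), mul_comm]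
    exact Nat.mul_le_mul_left _ (le_min hα hβ)

end Card

end Grid

section Paths

variable {α β γ C : Type*}

theorem gridCompatible_comp_fst {f g : α → C} (h : ∀ a b, a ≠ b → f a ≠ g b) :
    GridCompatible (β := β) (f ∘ Prod.fst) (g ∘ Prod.fst) :=
  fun v w h1 _ => h v.1 w.1 h1

theorem gridCompatible_comp_fst_self {f : α → C} (hf : f.Injective) :
    GridCompatible (β := β) (f ∘ Prod.fst) (f ∘ Prod.fst) :=
  gridCompatible_comp_fst fun _ _ => hf.ne

theorem loopStep_mul_swap_none [DecidableEq α] (τ : Equiv.Perm (Option α)) (c : α) :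
    LoopStep (GridCompatible (β := β)) (τ ∘ some ∘ Prod.fst)
      ((τ * Equiv.swap none (some c) : Equiv.Perm (Option α)) ∘ some ∘ Prod.fst) := by
  refine ⟨gridCompatible_comp_fst (f := τ ∘ some) (g := _ ∘ some) fun a b hab =>
      τ.injective.ne ?_,
    gridCompatible_comp_fst_self ((Equiv.injective _).comp (Option.some_injective α))⟩
  by_cases hb : b = c
  · simp [hb]
  · rw [Equiv.swap_apply_of_ne_of_ne (by simp) (by simpa using hb)]
    simpa using hab

/-- The spare color `none` lets us recolor one row at a time. -/
theorem reflTransGen_optionPerm [Finite α] (τ : Equiv.Perm (Option α)) :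
    Relation.ReflTransGen (LoopStep (GridCompatible (β := β))) (some ∘ Prod.fst)
      (τ ∘ some ∘ Prod.fst) := by
  classical
  induction τ using Equiv.Perm.swap_induction_on' with
  | one => exact .refl
  | mul_swap τ x y hxy ih =>
    refine ih.trans ?_
    rcases x, y with ⟨_ | a, _ | b⟩
    · exact absurd rfl hxy
    · exact .single (loopStep_mul_swap_none τ b)
    · rw [Equiv.swap_comm]
      exact .single (loopStep_mul_swap_none τ a)
    · have e : Equiv.swap (some a) (some b) =
          Equiv.swap none (some a) * Equiv.swap none (some b) * Equiv.swap none (some a) := by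
        rw [Equiv.swap_comm none (some b)]
        exact (Equiv.swap_mul_swap_mul_swap (by simp) hxy.symm).symm
      rw [e, ← mul_assoc, ← mul_assoc]
      exact .tail (.tail (.single (loopStep_mul_swap_none τ a)) (loopStep_mul_swap_none _ b))
        (loopStep_mul_swap_none _ a)

open Classical in
/-- The coloring of the grid `α × β` in which the column `z` is colored by `f` and every other
column has a color of its own. -/
noncomputable def mixedColoring (z : β) (f : α → γ) (v : α × β) : γ ⊕ {j : β // j ≠ z} :=
  if h : v.2 = z then .inl (f v.1) else .inr ⟨v.2, h⟩

theorem gridCompatible_mixedColoring (z : β) (f g : α → γ) :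
    GridCompatible (mixedColoring z f) (mixedColoring z g) := by
  rintro ⟨a, b⟩ ⟨a', b'⟩ _ h2
  simp only [mixedColoring]
  split_ifs <;> grind

theorem gridCompatible_comp_fst_mixedColoring (z : β) {f : α → γ} (hf : f.Injective) :
    GridCompatible (.inl ∘ f ∘ Prod.fst) (mixedColoring z f) := by
  rintro ⟨a, b⟩ ⟨a', b'⟩ h1 _
  have := hf.ne h1
  simp only [mixedColoring, Function.comp_apply]
  split_ifs <;> grind

theorem gridCompatible_mixedColoring_comp_snd (z : β) {g : β → γ} (hg : g.Injective) :
    GridCompatible (mixedColoring z fun _ : α => g z) (.inl ∘ g ∘ Prod.snd) := by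
  rintro ⟨a, b⟩ ⟨a', b'⟩ _ h2
  have := hg.ne h2
  simp only [mixedColoring, Function.comp_apply]
  split_ifs <;> grind

theorem reflTransGen_mixedColoring (z : β) {f : α → γ} (hf : f.Injective) (g : α → γ) :
    Relation.ReflTransGen (LoopStep GridCompatible) (.inl ∘ f ∘ Prod.fst) (mixedColoring z g) :=
  .tail (.single ⟨gridCompatible_comp_fst_mixedColoring z hf, gridCompatible_mixedColoring z f f⟩)
    ⟨gridCompatible_mixedColoring z f g, gridCompatible_mixedColoring z g g⟩

theorem reflTransGen_comp_fst (z : β) {f g : α → γ} (hf : f.Injective) (hg : g.Injective) :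
    Relation.ReflTransGen (LoopStep (GridCompatible (β := β) (C := γ ⊕ {j // j ≠ z})))
      (.inl ∘ f ∘ Prod.fst) (.inl ∘ g ∘ Prod.fst) :=
  (reflTransGen_mixedColoring z hf g).tail
    ⟨(gridCompatible_comp_fst_mixedColoring z hg).symm,
      gridCompatible_comp_fst_self (Sum.inl_injective.comp hg)⟩

theorem reflTransGen_comp_snd (z : β) {f : α → γ} {g : β → γ} (hf : f.Injective)
    (hg : g.Injective) :
    Relation.ReflTransGen (LoopStep (GridCompatible (C := γ ⊕ {j // j ≠ z})))
      (.inl ∘ f ∘ Prod.fst) (.inl ∘ g ∘ Prod.snd) :=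
  (reflTransGen_mixedColoring z hf fun _ => g z).tail
    ⟨gridCompatible_mixedColoring_comp_snd z hg,
      (gridCompatible_comp_fst_self (Sum.inl_injective.comp hg)).comp_swap⟩

end Paths

section Torus

variable {k : ℕ}

instance countable_gamma [NeZero k] : Countable (Gamma k) :=
  SemidirectProduct.equivProd.injective.countable

variable {C : Type*} {G H : ZMod k × ZMod k → C}

theorem GridCompatible.cayleyCompatible (h : GridCompatible G H) :
    CayleyCompatible (torusGens k) (G ∘ Multiplicative.toAdd) (H ∘ Multiplicative.toAdd) :=
  fun _ hs _ => h _ _ (by simpa using hs.1) (by simpa using hs.2)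

theorem reflTransGen_cayleyCompatible
    (h : Relation.ReflTransGen (LoopStep GridCompatible) G H) :
    Relation.ReflTransGen (LoopStep (CayleyCompatible (torusGens k)))
      (G ∘ Multiplicative.toAdd) (H ∘ Multiplicative.toAdd) :=
  h.lift (· ∘ Multiplicative.toAdd) fun _ _ h => ⟨h.1.cayleyCompatible, h.2.cayleyCompatible⟩

theorem swapHom_eq_or (n : Multiplicative ℤ) : swapHom k n = 1 ∨ swapHom k n = swapAut k := by
  have hsq : swapAut k ^ (2 : ℤ) = 1 := by
    rw [zpow_two]
    ext v <;> rfl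
  rw [swapHom, zpowersHom_apply]
  rcases Int.even_or_odd' n.toAdd with ⟨m, hm | hm⟩
  · exact .inl (by rw [hm, zpow_mul, hsq, one_zpow])
  · exact .inr (by rw [hm, zpow_add, zpow_mul, hsq, one_zpow, one_mul, zpow_one])

theorem swapHom_apply_mem_torusGens (n : Multiplicative ℤ) {v : Torus k} (hv : v ∈ torusGens k) :
    swapHom k n v ∈ torusGens k := by
  rcases swapHom_eq_or (k := k) n with h | h <;> rw [h]
  exacts [hv, swapAut_mem_torusGens hv]

theorem measureChromaticNumber_gamma_le (hk : 3 ≤ k) :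
    measureChromaticNumber (shiftGraph (gammaMarking k hk)) ≤ ((2 * k - 1 : ℕ) : ℕ∞) := by
  have : NeZero k := ⟨by omega⟩
  obtain ⟨c, hc, hproper⟩ := exists_measurable_coloring_of_reflTransGen (X := freePart (Gamma k))
    (C := ZMod k ⊕ {j : ZMod k // j ≠ 0}) (σ := (.inl ∘ id ∘ Prod.fst) ∘ Multiplicative.toAdd)
    (fun _ => inv_mem_torusGens) (fun n _ => swapHom_apply_mem_torusGens n)
    (fun _ => smul_freePart_ne)
    (gridCompatible_comp_fst_self Sum.inl_injective).cayleyCompatible fun n u => by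
      have htranslate := add_left_injective u.toAdd.1
      rcases swapHom_eq_or (k := k) n with h | h <;> rw [h]
      · exact reflTransGen_cayleyCompatible
          (reflTransGen_comp_fst 0 Function.injective_id htranslate)
      · exact reflTransGen_cayleyCompatible
          (reflTransGen_comp_snd 0 Function.injective_id htranslate)
  refine (measureChromaticNumber_shiftGraph_le hc hproper).trans_eq ?_
  rw [Nat.card_eq_fintype_card, Fintype.card_sum, Fintype.card_subtype_compl,
    Fintype.card_subtype_eq, ZMod.card, two_mul, Nat.add_sub_assoc NeZero.one_le]

theorem measureChromaticNumber_delta_le (hk : 3 ≤ k) :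
    measureChromaticNumber (shiftGraph (deltaMarking k hk)) ≤ ((k + 1 : ℕ) : ℕ∞) := by
  have : NeZero k := ⟨by omega⟩
  let e : Torus k ⋊[1] Multiplicative ℤ ≃* Delta k := SemidirectProduct.mulEquivProd
  let : MulAction (Torus k ⋊[1] Multiplicative ℤ) (freePart (Delta k)) :=
    .compHom _ e.toMonoidHom
  have : MeasurableConstSMul (Torus k ⋊[1] Multiplicative ℤ) (freePart (Delta k)) :=
    ⟨fun g => measurable_const_smul (e g)⟩
  obtain ⟨c, hc, hproper⟩ := exists_measurable_coloring_of_reflTransGen (φ := 1)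
    (X := freePart (Delta k)) (σ := (some ∘ Prod.fst) ∘ Multiplicative.toAdd)
    (fun _ => inv_mem_torusGens) (fun _ _ => id)
    (fun g hg => smul_freePart_ne (e.map_ne_one_iff.2 hg))
    (gridCompatible_comp_fst_self (Option.some_injective (ZMod k))).cayleyCompatible
    fun _ u => reflTransGen_cayleyCompatible
      (reflTransGen_optionPerm (Equiv.optionCongr (Equiv.addRight u.toAdd.1)))
  refine (measureChromaticNumber_shiftGraph_le hc fun s hs => ?_).trans_eq ?_
  · exact hproper ⟨s.1, s.2⟩ hs
  · rw [Nat.card_eq_fintype_card, Fintype.card_option, ZMod.card]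

end Torus

section Rotation

/-- The open half circle `(0, 1/2)`. -/
def arc : Set UnitAddCircle := (↑) '' Set.Ioo (0 : ℝ) (1 / 2)

theorem isOpen_coe_image {s : Set ℝ} (hs : IsOpen s) :
    IsOpen ((↑) '' s : Set UnitAddCircle) :=
  QuotientAddGroup.isOpenMap_coe s hs

theorem isOpen_arc : IsOpen arc :=
  isOpen_coe_image isOpen_Ioo

theorem arc_nonempty : arc.Nonempty :=
  (Set.nonempty_Ioo.2 (by norm_num)).image _

theorem disjoint_arc : Disjoint arc ((↑) '' Set.Ioo (1 / 2 : ℝ) 1) := by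
  refine Set.disjoint_left.2 ?_
  rintro _ ⟨a, ha, rfl⟩ ⟨b, hb, e⟩
  have h := (AddCircle.coe_eq_coe_iff_of_mem_Ico (p := (1 : ℝ)) (a := 0) (x := b) (y := a)
    ⟨by linarith [hb.1], by linarith [hb.2]⟩ ⟨ha.1.le, by linarith [ha.2]⟩).1 e
  linarith [ha.2, hb.1]

theorem exists_mem_arc_add_notMem_arc {ι : Type*} {f : ι → UnitAddCircle} (hf : DenseRange f)
    {β : UnitAddCircle} (hβ : β ≠ 0) : ∃ i, f i ∈ arc ∧ f i + β ∉ arc := by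
  obtain ⟨b, hb, rfl⟩ : ∃ b ∈ Set.Ico (0 : ℝ) (0 + 1), (b : UnitAddCircle) = β :=
    (AddCircle.coe_image_Ico_eq (1 : ℝ) 0).ge (Set.mem_univ β)
  rw [zero_add] at hb
  have hb0 : 0 < b := lt_of_le_of_ne hb.1 fun h => hβ (by rw [← h, AddCircle.coe_zero])
  have hopen : IsOpen (arc ∩ (· + (b : UnitAddCircle)) ⁻¹' ((↑) '' Set.Ioo (1 / 2 : ℝ) 1)) :=
    isOpen_arc.inter ((isOpen_coe_image isOpen_Ioo).preimage (continuous_add_const _))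
  obtain ⟨i, hi, hib⟩ := hf.exists_mem_open hopen
    ⟨(((1 - b) / 2 : ℝ) : UnitAddCircle), ⟨_, ⟨by linarith [hb.2], by linarith⟩, rfl⟩,
      ⟨(1 + b) / 2, ⟨by linarith, by linarith [hb.2]⟩, by
        simp only [← AddCircle.coe_add]
        congr 1
        ring⟩⟩
  exact ⟨i, hi, disjoint_arc.notMem_of_mem_right hib⟩

theorem exists_addOrderOf_eq_zero : ∃ ω : UnitAddCircle, addOrderOf ω = 0 :=
  ⟨((√2 : ℝ) : UnitAddCircle), AddCircle.denseRange_zsmul_iff.1 <|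
    AddCircle.denseRange_zsmul_coe_iff.2 (by simpa using irrational_sqrt_two)⟩

instance isProbabilityMeasure_circle : IsProbabilityMeasure (volume : Measure UnitAddCircle) :=
  ⟨UnitAddCircle.measure_univ⟩

variable {ω : UnitAddCircle} (hω : addOrderOf ω = 0)

include hω in
theorem exists_add_eq_of_periodic {C : Type*} [MeasurableSpace C]
    [MeasurableSpace.CountablySeparated C] {κ : UnitAddCircle → C} (hκ : NullMeasurable κ volume)
    {n : ℕ} (hn : n ≠ 0) (hper : ∀ θ, κ (θ + n • ω) = κ θ) : ∃ θ, κ (θ + ω) = κ θ := by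
  have : Nonempty C := ⟨κ 0⟩
  have hergodic : Ergodic fun θ : UnitAddCircle => θ + n • ω := by
    rw [AddCircle.ergodic_add_right, addOrderOf_nsmul' _ hn, hω, Nat.zero_div]
  obtain ⟨d, hd⟩ := hergodic.ae_eq_const_of_ae_eq_comp₀ hκ (.of_eq (funext hper))
  have hconst : ∀ᵐ θ : UnitAddCircle, κ θ = d := hd
  have hconst' : ∀ᵐ θ : UnitAddCircle, κ (θ + ω) = d :=
    (measurePreserving_add_right (volume : Measure UnitAddCircle) ω).quasiMeasurePreserving.ae
      (p := fun θ => κ θ = d) hconst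
  obtain ⟨θ, h, h'⟩ := (hconst.and hconst').exists
  exact ⟨θ, h'.trans h.symm⟩

variable {Γ : Type*} [Group Γ] {t : Γ}

open Classical in
/-- The point of `2^Γ` supported on the powers of `t` which records the visits of the backward orbit
of `θ` under the rotation by `ω` to the arc. -/
noncomputable def itinerary (t : Γ) (ω θ : UnitAddCircle) (h : Γ) : Bool :=
  decide (∃ n : ℤ, t ^ n = h ∧ θ - n • ω ∈ arc)

theorem itinerary_eq_true {θ : UnitAddCircle} {h : Γ} :
    itinerary t ω θ h = true ↔ ∃ n : ℤ, t ^ n = h ∧ θ - n • ω ∈ arc := by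
  simp [itinerary]

theorem shift_zpow_itinerary (d : ℤ) (θ : UnitAddCircle) :
    shift (t ^ d) (itinerary t ω θ) = itinerary t ω (θ + d • ω) := by
  funext h
  rw [Bool.eq_iff_iff, shift, itinerary_eq_true, itinerary_eq_true]
  refine (Equiv.addLeft d).exists_congr fun n => ?_
  rw [Equiv.coe_addLeft, zpow_add, eq_inv_mul_iff_mul_eq, add_comm θ, add_smul,
    add_sub_add_left_eq_sub]

theorem measurable_itinerary : Measurable (itinerary t ω) := by
  refine measurable_pi_iff.2 fun h => measurable_to_bool ?_
  have e : (fun θ => itinerary t ω θ h) ⁻¹' {true} =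
      ⋃ (n : ℤ) (_ : t ^ n = h), (fun θ => θ - n • ω) ⁻¹' arc := by
    ext θ
    simp [itinerary_eq_true]
  rw [e]
  exact (isOpen_iUnion fun n => isOpen_iUnion fun _ =>
    isOpen_arc.preimage (continuous_sub_right _)).measurableSet

variable (ht : ¬ IsOfFinOrder t)

include ht in
theorem itinerary_zpow {θ : UnitAddCircle} {n : ℤ} :
    itinerary t ω θ (t ^ n) = true ↔ θ - n • ω ∈ arc := by
  rw [itinerary_eq_true]
  constructor
  · rintro ⟨m, hm, h⟩
    rwa [← injective_zpow_iff_not_isOfFinOrder.2 ht hm]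
  · exact fun h => ⟨n, rfl, h⟩

include hω ht in
theorem itinerary_mem_freePart (θ : UnitAddCircle) : itinerary t ω θ ∈ freePart Γ := by
  intro g hg e
  have hdense : DenseRange fun n : ℤ => θ - n • ω :=
    (Homeomorph.subLeft θ).surjective.denseRange.comp (AddCircle.denseRange_zsmul_iff.2 hω)
      (Homeomorph.subLeft θ).continuous
  obtain ⟨d, rfl⟩ : ∃ d : ℤ, t ^ d = g := by
    obtain ⟨n, hn⟩ := hdense.exists_mem_open isOpen_arc arc_nonempty
    have hgn : itinerary t ω θ (g⁻¹ * t ^ n) = true :=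
      (congrFun e (t ^ n)).trans ((itinerary_zpow ht).2 hn)
    obtain ⟨m, hm, -⟩ := itinerary_eq_true.1 hgn
    exact ⟨n - m, by rw [zpow_sub, hm, mul_inv_rev, inv_inv, mul_inv_cancel_left]⟩
  have hd : d • ω ≠ 0 := fun h => hg <| by
    have h0 : d = 0 := injective_zsmul_iff_not_isOfFinAddOrder.2 (addOrderOf_eq_zero_iff.1 hω)
      (h.trans (zero_smul ℤ ω).symm)
    rw [h0, zpow_zero]
  obtain ⟨n, hn, hnd⟩ := exists_mem_arc_add_notMem_arc hdense hd
  rw [← itinerary_zpow ht, ← e, shift_zpow_itinerary, itinerary_zpow ht,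
    add_sub_right_comm] at hn
  exact hnd hn

include hω ht in
theorem exists_equivariant_map :
    ∃ p : UnitAddCircle → freePart Γ, Measurable p ∧ ∀ (n : ℤ) θ, t ^ n • p θ = p (θ + n • ω) := by
  refine ⟨fun θ => ⟨itinerary t ω θ, itinerary_mem_freePart hω ht θ⟩,
    measurable_itinerary.subtype_mk, fun n θ => Subtype.ext (shift_zpow_itinerary n θ)⟩

end Rotation

section LowerBounds

variable {k : ℕ} {Γ C : Type*} [Group Γ]

/-- The coloring of the grid `Z_k × Z_k` which is read off from `c` along the coset of `y`. -/
def slice (ι : Torus k →* Γ) (c : freePart Γ → C) (y : freePart Γ) (v : ZMod k × ZMod k) : C :=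
  c (ι (.ofAdd v) • y)

theorem gridCompatible_slice {S : Marking Γ} (c : (shiftGraph S).Coloring C) {ι : Torus k →* Γ}
    {t : Γ} {ψ : ZMod k × ZMod k → ZMod k × ZMod k}
    (ht : ∀ v, t * ι (.ofAdd v) = ι (.ofAdd (ψ v)) * t) (hS : ∀ s ∈ torusGens k, t * ι s ∈ S.gens)
    (y : freePart Γ) : GridCompatible (slice ι c y) (slice ι c (t • y) ∘ ψ) := by
  intro v w h1 h2
  have hmem : Multiplicative.ofAdd (w - v) ∈ torusGens k :=
    ⟨sub_ne_zero.2 h1.symm, sub_ne_zero.2 h2.symm⟩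
  have hadj := shiftGraph_adj_smul (hS _ hmem) (ι (.ofAdd v) • y)
  rw [← mul_smul, mul_assoc, ← map_mul, ← ofAdd_add, sub_add_cancel, ht, mul_smul] at hadj
  exact c.valid hadj

theorem gridCompatible_slice_self {S : Marking Γ} (c : (shiftGraph S).Coloring C)
    {ι : Torus k →* Γ} (hS : ∀ s ∈ torusGens k, ι s ∈ S.gens) (y : freePart Γ) :
    GridCompatible (slice ι c y) (slice ι c y) := by
  simpa using gridCompatible_slice c (t := 1) (ψ := id) (by simp) (by simpa using hS) y

theorem one_mem_steps : (1 : Multiplicative ℤ) ∈ steps :=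
  .inr (.inl rfl)

theorem ofAdd_one_mem_steps : (.ofAdd 1 : Multiplicative ℤ) ∈ steps :=
  .inr (.inr rfl)

theorem not_isOfFinOrder_ofAdd_one : ¬ IsOfFinOrder (Multiplicative.ofAdd (1 : ℤ)) := by
  rw [isOfFinOrder_ofAdd_iff]
  exact not_isOfFinAddOrder_of_isAddTorsionFree one_ne_zero

theorem coloring_delta_smul_eq {hk : 3 ≤ k} [Fintype C] (hC : Fintype.card C ≤ k)
    (c : (shiftGraph (deltaMarking k hk)).Coloring C) (n : ℕ) (y : freePart (Delta k)) :
    c (((1, .ofAdd 1) : Delta k) ^ n • y) = c y := by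
  have : NeZero k := ⟨by omega⟩
  let ι : Torus k →* Delta k := MonoidHom.inl _ _
  let t : Delta k := (1, .ofAdd 1)
  have hself (x) : GridCompatible (slice ι c x) (slice ι c x) :=
    gridCompatible_slice_self c (fun _ hs => ⟨hs, one_mem_steps⟩) x
  have hnext (x) : GridCompatible (slice ι c x) (slice ι c (t • x)) :=
    gridCompatible_slice c (ψ := id) (fun v => by simp [ι, t])
      (fun s hs => ⟨by simpa [ι, t] using hs, by simpa [ι, t] using ofAdd_one_mem_steps⟩) x
  have hC' : Fintype.card C ≤ Fintype.card (ZMod k) := by rwa [ZMod.card]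
  have hstep (x) : c (t • x) = c x := by
    have := congrFun ((hself x).eq (hself _) (hnext x) hC' hC') 0
    simpa [slice] using this.symm
  induction n with
  | zero => rw [pow_zero, one_smul]
  | succ n ih => rw [pow_succ', mul_smul, hstep, ih]

theorem le_measureChromaticNumber_delta (hk : 3 ≤ k) :
    ((k + 1 : ℕ) : ℕ∞) ≤ measureChromaticNumber (shiftGraph (deltaMarking k hk)) := by
  have : Fact (1 < k) := ⟨by omega⟩
  let t : Delta k := (.ofAdd (1, 1), .ofAdd 1)
  have htS : t ∈ (deltaMarking k hk).gens := ⟨⟨one_ne_zero, one_ne_zero⟩, ofAdd_one_mem_steps⟩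
  have ht : ¬ IsOfFinOrder t := fun h =>
    not_isOfFinOrder_ofAdd_one ((MonoidHom.snd (Torus k) (Multiplicative ℤ)).isOfFinOrder h)
  have htk : t ^ k = (1, .ofAdd 1) ^ k := by
    ext1
    · simp [t, ← ofAdd_nsmul]
    · rfl
  obtain ⟨ω, hω⟩ := exists_addOrderOf_eq_zero
  obtain ⟨p, hp, hequiv⟩ := exists_equivariant_map hω ht
  have hnext (θ) : t • p θ = p (θ + ω) := by simpa using hequiv 1 θ
  refine le_measureChromaticNumber volume (q := fun _ : Unit => p) (fun _ => hp)
    fun m hm c hc => ?_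
  obtain ⟨θ, hθ⟩ := exists_add_eq_of_periodic hω (hc ()) (n := k) (by omega) fun θ => by
    rw [← natCast_zsmul, ← hequiv, zpow_natCast, htk,
      coloring_delta_smul_eq (by simpa using Nat.lt_succ_iff.1 hm)]
  rw [← hnext] at hθ
  exact c.valid (shiftGraph_adj_smul htS _) hθ.symm

theorem noRainbowRow_slice_gamma_iff {hk : 3 ≤ k} [Fintype C] (hC : Fintype.card C + 1 < 2 * k)
    (c : (shiftGraph (gammaMarking k hk)).Coloring C) (y : freePart (Gamma k)) :
    NoRainbowRow (slice SemidirectProduct.inl c ((.inr (.ofAdd 1) : Gamma k) • y)) ↔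
      ¬ NoRainbowRow (slice SemidirectProduct.inl c y) := by
  have : NeZero k := ⟨by omega⟩
  have hself (x) :
      GridCompatible (slice SemidirectProduct.inl c x) (slice SemidirectProduct.inl c x) :=
    gridCompatible_slice_self c (fun _ hs => ⟨hs, one_mem_steps⟩) x
  have hnext : GridCompatible (slice SemidirectProduct.inl c y)
      (slice SemidirectProduct.inl c ((.inr (.ofAdd 1) : Gamma k) • y) ∘ Prod.swap) := by
    refine gridCompatible_slice c (fun v => ?_) (fun s hs => ⟨?_, ?_⟩) y
    · have hswap : swapHom k (.ofAdd 1) (.ofAdd v) = .ofAdd v.swap := by rw [swapHom_one]; rfl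
      rw [← hswap, SemidirectProduct.inl_aut, map_inv, inv_mul_cancel_right]
    · simpa [swapHom_one] using swapAut_mem_torusGens hs
    · simpa using ofAdd_one_mem_steps
  have hcard : Fintype.card C + 1 < Fintype.card (ZMod k) + Fintype.card (ZMod k) := by
    rwa [ZMod.card, ← two_mul]
  rw [(hself y).noRainbowRow_iff (hself _).comp_swap hnext hcard,
    noRainbowRow_comp_swap_iff (hself _) hcard, not_not]

theorem le_measureChromaticNumber_gamma (hk : 3 ≤ k) :
    ((2 * k - 1 : ℕ) : ℕ∞) ≤ measureChromaticNumber (shiftGraph (gammaMarking k hk)) := by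
  have : NeZero k := ⟨by omega⟩
  let t : Gamma k := .inr (.ofAdd 1)
  have ht : ¬ IsOfFinOrder t :=
    (SemidirectProduct.inr_injective.isOfFinOrder_iff).not.2 not_isOfFinOrder_ofAdd_one
  obtain ⟨ω, hω⟩ := exists_addOrderOf_eq_zero
  obtain ⟨p, hp, hequiv⟩ := exists_equivariant_map hω ht
  let q (v : ZMod k × ZMod k) (θ : UnitAddCircle) : freePart (Gamma k) :=
    (.inl (.ofAdd v) : Gamma k) • p θ
  refine le_measureChromaticNumber volume (q := q) (fun v => (measurable_const_smul _).comp hp)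
    fun m hm c hc => ?_
  let κ (θ : UnitAddCircle) : Prop := NoRainbowRow (slice SemidirectProduct.inl c (p θ))
  have hslice : AEMeasurable (fun θ => slice SemidirectProduct.inl c (p θ)) volume :=
    aemeasurable_pi_lambda _ fun v => (hc v).aemeasurable
  have hκ : NullMeasurable κ volume :=
    ((Measurable.of_discrete (f := NoRainbowRow)).comp_aemeasurable hslice).nullMeasurable
  have hnext (θ) : t • p θ = p (θ + ω) := by simpa using hequiv 1 θ
  have hflip (θ) : κ (θ + ω) ↔ ¬ κ θ := by
    simp only [κ, ← hnext]
    exact noRainbowRow_slice_gamma_iff (by rw [Fintype.card_fin]; omega) c (p θ)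
  obtain ⟨θ, hθ⟩ := exists_add_eq_of_periodic hω hκ two_ne_zero fun θ => by
    rw [two_nsmul, ← add_assoc, hflip, hflip, not_not]
  exact not_iff_self ((hflip θ).symm.trans hθ.to_iff)

end LowerBounds

end ShiftGraphs

theorem proposition4p2 (k : ℕ) (hk : 3 ≤ k) :
    ShiftGraphs.measureChromaticNumber (ShiftGraphs.shiftGraph (ShiftGraphs.gammaMarking k hk)) =
        ((2 * k - 1 : ℕ) : ℕ∞) ∧
      ShiftGraphs.measureChromaticNumber (ShiftGraphs.shiftGraph (ShiftGraphs.deltaMarking k hk)) =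
        ((k + 1 : ℕ) : ℕ∞) :=
  ⟨le_antisymm (ShiftGraphs.measureChromaticNumber_gamma_le hk)
      (ShiftGraphs.le_measureChromaticNumber_gamma hk),
    le_antisymm (ShiftGraphs.measureChromaticNumber_delta_le hk)
      (ShiftGraphs.le_measureChromaticNumber_delta hk)⟩
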